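/- Let $K$ be a field and $R=\bigoplus_{i\ge 0}R_i$ a commutative, finitely generated, positively graded $K$-algebra with $R_0=K$ (the generators may have arbitrary positive degrees). Let $M=\bigoplus_{i\in\mathbb Z}M_i$ be a non-zero finitely generated graded $R$-module of Krull dimension $d$. A quasi-polynomial is an expression $Q(n)=\sum_{i\ge 0}a_i(n)n^i$ with periodic coefficient functions $a_i:\mathbb Z\to\mathbb C$, only finitely many of which are non-zero. Its period is the smallest integer $\pi>0$ with $a_i(n+\pi)=a_i(n)$ for all $n\in\mathbb Z$ and all $i$, and its grade is the smallest integer $\delta\ge -1$ such that $a_i$ is constant for every $i>\delta$. There is a unique quasi-polynomial $$Q(n)=a_{d-1}(n)n^{d-1}+\dots+a_1(n)n+a_0(n)$$ with $\dim_K M_n=Q(n)$ for all sufficiently large integers $n$ (the Hilbert quasi-polynomial of $M$; it is $0$ if $d=0$). Let $\pi$ be its period, and let $I$ be the ideal of $R$ generated by all homogeneous elements $x\in R$ of positive degree with $\gcd(\deg x,\pi)=1$. Then $$\operatorname{grade} Q<\dim M/IM .$$ -/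

import Mathlib

/-- A quasi-polynomial `n ↦ ∑ i, a_i(n) n ^ i`: only finitely many coefficient functions
`a_i : ℤ → ℂ` are non-zero, and each of them is periodic. -/
@[ext]
structure QuasiPolynomial where
  /-- the coefficient functions `a_i` -/
  coeff : ℕ →₀ (ℤ → ℂ)
  exists_periodic : ∀ i, ∃ p : ℕ, 0 < p ∧ Function.Periodic (coeff i) (p : ℤ)

namespace QuasiPolynomial

/-- The value of a quasi-polynomial at an integer. -/
noncomputable def eval (Q : QuasiPolynomial) (n : ℤ) : ℂ :=
  Q.coeff.sum fun i a => a n * (n : ℂ) ^ i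

/-- The period: the smallest positive integer that is a period of all coefficients. -/
noncomputable def period (Q : QuasiPolynomial) : ℕ :=
  sInf {p : ℕ | 0 < p ∧ ∀ i, Function.Periodic (Q.coeff i) (p : ℤ)}

/-- The grade: the smallest integer `δ ≥ -1` such that `a_i` is constant for all `i > δ`. -/
noncomputable def grade (Q : QuasiPolynomial) : ℤ :=
  sInf {δ : ℤ | -1 ≤ δ ∧ ∀ i : ℕ, δ < (i : ℤ) → ∃ c : ℂ, ∀ n : ℤ, Q.coeff i n = c}

theorem isLeast_period (Q : QuasiPolynomial) :
    IsLeast {p : ℕ | 0 < p ∧ ∀ i, Function.Periodic (Q.coeff i) (p : ℤ)} Q.period := by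
  have hne : {p : ℕ | 0 < p ∧ ∀ i, Function.Periodic (Q.coeff i) (p : ℤ)}.Nonempty := by
    choose p hp hper using Q.exists_periodic
    refine ⟨∏ i ∈ Q.coeff.support, p i, Finset.prod_pos fun i _ => hp i, fun i => ?_⟩
    by_cases hi : i ∈ Q.coeff.support
    · obtain ⟨k, hk⟩ := Finset.dvd_prod_of_mem p hi
      rw [hk, mul_comm, Nat.cast_mul]
      exact (hper i).nat_mul k
    · rw [Finsupp.notMem_support_iff.mp hi]
      intro n
      rfl
  exact ⟨Nat.sInf_mem hne, fun q hq => Nat.sInf_le hq⟩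

theorem isLeast_grade (Q : QuasiPolynomial) :
    IsLeast {δ : ℤ | -1 ≤ δ ∧ ∀ i : ℕ, δ < (i : ℤ) → ∃ c : ℂ, ∀ n : ℤ, Q.coeff i n = c}
      Q.grade := by
  have hb : BddBelow
      {δ : ℤ | -1 ≤ δ ∧ ∀ i : ℕ, δ < (i : ℤ) → ∃ c : ℂ, ∀ n : ℤ, Q.coeff i n = c} :=
    ⟨-1, fun δ hδ => hδ.1⟩
  refine ⟨Int.csInf_mem ⟨(Q.coeff.support.sup id : ℕ), by omega, fun i hi => ⟨0, fun n => ?_⟩⟩ hb,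
    fun δ hδ => csInf_le hb hδ⟩
  have : i ∉ Q.coeff.support := fun h => by
    have h2 : i ≤ Q.coeff.support.sup id := Finset.le_sup (f := id) h
    omega
  rw [Finsupp.notMem_support_iff.mp this]
  rfl

/-- `Q` is a Hilbert quasi-polynomial of the graded `K`-vector space `ℳ`: it agrees with the
Hilbert function `n ↦ dim_K ℳ n` for all sufficiently large integers `n`. -/
def IsHilbert {K M : Type*} [Field K] [AddCommGroup M] [Module K M]
    (Q : QuasiPolynomial) (ℳ : ℤ → Submodule K M) : Prop :=
  ∀ᶠ n : ℤ in Filter.atTop, Q.eval n = (Module.finrank K (ℳ n) : ℂ)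

end QuasiPolynomial

/-- The ideal generated by the homogeneous elements of positive degree coprime to `q`.
(Degree `0` is coprime to `q` only for `q = 1`.) -/
def coprimeDegreeIdeal {K R : Type*} [Field K] [CommRing R] [Algebra K R]
    (𝒜 : ℕ → Submodule K R) (q : ℕ) : Ideal R :=
  Ideal.span {x : R | ∃ i : ℕ, 0 < i ∧ Nat.Coprime i q ∧ x ∈ 𝒜 i}

/-! Let polynomials act on sequences by sending `X` to the shift, and work modulo eventually zero
sequences. Quasi-polynomials correspond to sequences killed by some `(X ^ N - 1) ^ L`. A root of
unity `ζ` that is a characteristic root of multiplicity at most `e` contributes `ζ ^ n` times a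
polynomial in `n` of degree below `e`. So the grade is below `e` once the sequence is killed by `g *
(X ^ π - 1) ^ e` with `g` coprime to `1 + X + ... + X ^ (π - 1)`: roots `ζ ≠ 1` with `ζ ^ π = 1`
then have multiplicity at most `e`, while the root `1` only yields constant coefficients
(`exists_coeff_eq_of_annihilates`).

Such an annihilator of the Hilbert function comes from Noetherian induction on homogeneous
submodules `N`, applied to `M / N` (`exists_annihilates_hilbertFun`). Multiplication by a
homogeneous `x` of degree `i` reduces `N` to `(N : x)` and `N + xM`. If `x` is injective on `M / N`,
then `X ^ i - 1` carries the Hilbert function of `M / N` to a shift of that of `M / (N + xM)`. When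
`i` is coprime to `π`, this factor is coprime to the geometric sum and costs nothing. If all such
`x` kill `M / N`, then `M / N` is a quotient of `M / IM`. Any other injective `x` of positive degree
lowers the dimension by one and uses up one factor `X ^ π - 1`, since `X ^ i - 1` is squarefree.
Hence `e = dim M / IM` factors suffice.

The same induction with other sets of free degrees and free factors gives the existence of `Q` and
the bound on its degree. -/

open Polynomial Filter

/-! ### Linear recurrences modulo eventually zero sequences -/

/-- The shift `f ↦ (n ↦ f (n + 1))` on two-sided sequences. -/
noncomputable def seqShift : Module.End ℂ (ℤ → ℂ) :=
  LinearMap.funLeft ℂ ℂ (fun n : ℤ => n + 1)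

theorem seqShift_pow_apply (k : ℕ) (f : ℤ → ℂ) (n : ℤ) : (seqShift ^ k) f n = f (n + k) := by
  induction k generalizing n with
  | zero => simp
  | succ k ih =>
    rw [pow_succ', Module.End.mul_apply]
    change (seqShift ^ k) f (n + 1) = _
    rw [ih]
    push_cast
    ring_nf

/-- The sequences that vanish for all sufficiently large arguments. -/
def eventuallyZero : Submodule ℂ (ℤ → ℂ) where
  carrier := {f | ∀ᶠ n in atTop, f n = 0}
  zero_mem' := Eventually.of_forall fun _ => rfl
  add_mem' {f g} hf hg := by
    filter_upwards [hf, hg] with n h1 h2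
    simp [h1, h2]
  smul_mem' c f hf := by
    filter_upwards [hf] with n h1
    simp [h1]

theorem mem_eventuallyZero {f : ℤ → ℂ} : f ∈ eventuallyZero ↔ ∀ᶠ n in atTop, f n = 0 := Iff.rfl

theorem seqShift_pow_mem_iff {k : ℕ} {f : ℤ → ℂ} :
    (seqShift ^ k) f ∈ eventuallyZero ↔ f ∈ eventuallyZero := by
  simp only [mem_eventuallyZero, seqShift_pow_apply, eventually_atTop]
  constructor
  · rintro ⟨a, ha⟩
    refine ⟨a + k, fun n hn => ?_⟩
    have := ha (n - k) (by omega)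
    rwa [sub_add_cancel] at this
  · rintro ⟨a, ha⟩
    exact ⟨a, fun n hn => ha _ (by omega)⟩

theorem aeval_seqShift_mem (p : ℂ[X]) {f : ℤ → ℂ} (hf : f ∈ eventuallyZero) :
    aeval seqShift p f ∈ eventuallyZero := by
  rw [aeval_eq_sum_range, LinearMap.sum_apply]
  exact Submodule.sum_mem _ fun i _ =>
    Submodule.smul_mem _ _ (seqShift_pow_mem_iff.mpr hf)

/-- The sequence `f` satisfies, for large arguments, the linear recurrence with characteristic
polynomial `p`. -/
def Annihilates (p : ℂ[X]) (f : ℤ → ℂ) : Prop := aeval seqShift p f ∈ eventuallyZero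

namespace Annihilates

theorem of_mem (p : ℂ[X]) {f : ℤ → ℂ} (hf : f ∈ eventuallyZero) : Annihilates p f :=
  aeval_seqShift_mem p hf

theorem mul_iff {p r : ℂ[X]} {f : ℤ → ℂ} :
    Annihilates (p * r) f ↔ Annihilates p (aeval seqShift r f) := by
  rw [Annihilates, map_mul]
  rfl

theorem mul_left {r : ℂ[X]} {f : ℤ → ℂ} (p : ℂ[X]) (h : Annihilates r f) :
    Annihilates (p * r) f :=
  mul_iff.mpr (of_mem p h)

theorem of_dvd {p r : ℂ[X]} {f : ℤ → ℂ} (h : Annihilates p f) (hd : p ∣ r) :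
    Annihilates r f := by
  obtain ⟨c, rfl⟩ := hd
  rw [mul_comm]
  exact h.mul_left c

theorem add {p : ℂ[X]} {f g : ℤ → ℂ} (hf : Annihilates p f) (hg : Annihilates p g) :
    Annihilates p (f + g) := by
  rw [Annihilates, map_add]
  exact Submodule.add_mem _ hf hg

theorem congr {p : ℂ[X]} {f g : ℤ → ℂ} (hf : Annihilates p f) (h : g - f ∈ eventuallyZero) :
    Annihilates p g := by
  have := hf.add (of_mem p h)
  rwa [add_sub_cancel] at this

/-- The shift is invertible modulo eventually zero sequences and commutes with every polynomial in
it. -/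
theorem seqShift_pow_iff {p : ℂ[X]} {k : ℕ} {f : ℤ → ℂ} :
    Annihilates p ((seqShift ^ k) f) ↔ Annihilates p f := by
  have h : (seqShift ^ k) f = aeval seqShift (X ^ k : ℂ[X]) f := by simp
  rw [h, ← mul_iff, mul_comm, mul_iff]
  simp only [Annihilates, map_pow, aeval_X]
  exact seqShift_pow_mem_iff

theorem mem_of_isCoprime {a b : ℂ[X]} {f : ℤ → ℂ} (hab : IsCoprime a b)
    (ha : Annihilates a f) (hb : Annihilates b f) : f ∈ eventuallyZero := by
  obtain ⟨u, v, huv⟩ := hab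
  have h : aeval seqShift (u * a + v * b) f ∈ eventuallyZero := by
    rw [map_add]
    exact Submodule.add_mem _ (ha.mul_left u) (hb.mul_left v)
  simpa [huv] using h

/-- Bézout applied to the sequence `c` produces from `f`. This is how unwanted factors are removed
from an annihilator. -/
theorem of_mul_isCoprime {a b c : ℂ[X]} {f : ℤ → ℂ} (hab : IsCoprime a b)
    (ha : Annihilates (a * c) f) (hb : Annihilates (b * c) f) : Annihilates c f :=
  mem_of_isCoprime hab (mul_iff.mp ha) (mul_iff.mp hb)

theorem exists_add_of_isCoprime {a b : ℂ[X]} {f : ℤ → ℂ} (hab : IsCoprime a b)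
    (h : Annihilates (a * b) f) : ∃ g g', f = g + g' ∧ Annihilates a g ∧ Annihilates b g' := by
  obtain ⟨u, v, huv⟩ := hab
  refine ⟨aeval seqShift (v * b) f, aeval seqShift (u * a) f, ?_, ?_, ?_⟩
  · rw [← LinearMap.add_apply, ← map_add, add_comm, huv]
    simp
  · exact mul_iff.mp (h.of_dvd ⟨v, by ring⟩)
  · exact mul_iff.mp (h.of_dvd ⟨u, by ring⟩)

end Annihilates

/-! ### Finite differences and polynomials on residue classes -/

theorem aeval_seqShift_X_pow_sub_one (d : ℕ) (f : ℤ → ℂ) :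
    aeval seqShift (X ^ d - 1 : ℂ[X]) f = fwdDiff (d : ℤ) f := by
  ext n
  simp [fwdDiff, seqShift_pow_apply]

theorem aeval_seqShift_X_pow_sub_one_pow (d k : ℕ) (f : ℤ → ℂ) :
    aeval seqShift ((X ^ d - 1) ^ k : ℂ[X]) f = (fwdDiff (d : ℤ))^[k] f := by
  induction k with
  | zero => simp
  | succ k ih =>
    rw [pow_succ', map_mul, Module.End.mul_apply, ih, aeval_seqShift_X_pow_sub_one,
      Function.iterate_succ_apply']

/-- A difference with step `q` treats the `q`-periodic `a` as a constant, so by the binomial theorem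
it lowers the degree in `n`. -/
theorem annihilates_X_pow_sub_one_pow_of_periodic {q : ℕ} {a : ℤ → ℂ}
    (ha : Function.Periodic a (q : ℤ)) (i : ℕ) {L : ℕ} (hL : i < L) :
    aeval seqShift ((X ^ q - 1) ^ L : ℂ[X]) (fun n => a n * (n : ℂ) ^ i) = 0 := by
  induction L generalizing i with
  | zero => omega
  | succ L ih =>
    rw [pow_succ, map_mul, Module.End.mul_apply, aeval_seqShift_X_pow_sub_one]
    have h : fwdDiff (q : ℤ) (fun n => a n * (n : ℂ) ^ i) =
        ∑ j ∈ Finset.range i, ((q : ℂ) ^ (i - j) * (i.choose j : ℂ)) •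
          fun n : ℤ => a n * (n : ℂ) ^ j := by
      ext n
      simp only [fwdDiff, ha n, Finset.sum_apply, Pi.smul_apply, smul_eq_mul]
      push_cast
      rw [add_pow, Finset.sum_range_succ, mul_add]
      simp only [tsub_self, pow_zero, Nat.choose_self, Nat.cast_one, mul_one, add_sub_cancel_right,
        Finset.mul_sum]
      exact Finset.sum_congr rfl fun j _ => by ring
    rw [h, map_sum]
    refine Finset.sum_eq_zero fun j hj => ?_
    rw [map_smul, ih j (by have := Finset.mem_range.mp hj; omega), smul_zero]

/-- A sequence killed by `(X ^ N - 1) ^ L` is, on each residue class, a polynomial of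
degree less than `L`. -/
theorem Annihilates.exists_polynomial {N L : ℕ} (hN : 0 < N) {f : ℤ → ℂ}
    (h : Annihilates ((X ^ N - 1) ^ L) f) :
    ∃ P : ℤ → ℂ[X], Function.Periodic P (N : ℤ) ∧ (∀ n, (P n).degree < L) ∧
      ∀ᶠ n : ℤ in atTop, f n = (P n).eval (n : ℂ) := by
  rw [Annihilates, aeval_seqShift_X_pow_sub_one_pow] at h
  obtain ⟨n₀, hn₀⟩ := eventually_atTop.mp h
  have hN' : (N : ℂ) ≠ 0 := by exact_mod_cast hN.ne'
  -- `y n` is the representative of `n` modulo `N` in `[n₀, n₀ + N)`, and `P n` is the Newton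
  -- expansion of `f` from there in the variable `(X - y n) / N`. Stopping before `L` is exact
  -- because the differences of order at least `L` vanish from `n₀` on.
  let y : ℤ → ℤ := fun n => n₀ + (n - n₀) % N
  let P : ℤ → ℂ[X] := fun n => ∑ k ∈ Finset.range L,
    C ((fwdDiff (N : ℤ))^[k] f (y n) / (k.factorial : ℂ)) *
      (descPochhammer ℂ k).comp (C (N : ℂ)⁻¹ * (X - C (y n : ℂ)))
  refine ⟨P, fun n => ?_, fun n => ?_, eventually_atTop.mpr ⟨n₀, fun n hn => ?_⟩⟩
  · have : y (n + N) = y n := by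
      simp only [y, show n + N - n₀ = n - n₀ + N by ring, Int.add_emod_right]
    simp only [P, this]
  · rw [Polynomial.degree_lt_iff_coeff_zero]
    intro m hm
    rw [finsetSum_coeff]
    refine Finset.sum_eq_zero fun k hk => ?_
    apply coeff_eq_zero_of_natDegree_lt
    refine lt_of_le_of_lt (natDegree_C_mul_le _ _) ?_
    refine lt_of_le_of_lt natDegree_comp_le ?_
    rw [descPochhammer_natDegree]
    have h1 : (C (N : ℂ)⁻¹ * (X - C (y n : ℂ))).natDegree ≤ 1 :=
      (natDegree_C_mul_le _ _).trans (natDegree_X_sub_C_le _)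
    have := Finset.mem_range.mp hk
    nlinarith
  · obtain ⟨j, hj⟩ : ∃ j : ℕ, n = y n + j • (N : ℤ) := by
      refine ⟨((n - n₀) / N).toNat, ?_⟩
      rw [nsmul_eq_mul, Int.toNat_of_nonneg (Int.ediv_nonneg (by omega) (by omega))]
      have := Int.emod_add_mul_ediv (n - n₀) N
      simp only [y]
      linarith
    have hy : n₀ ≤ y n := by
      have := Int.emod_nonneg (n - n₀) (b := N) (by omega)
      simp only [y]
      omega
    have hz : ∀ k, L ≤ k → (fwdDiff (N : ℤ))^[k] f (y n) = 0 := by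
      intro k hk
      obtain ⟨r, rfl⟩ := Nat.exists_eq_add_of_le' hk
      rw [Function.iterate_add_apply]
      have : ∀ r : ℕ, ∀ m, n₀ ≤ m → (fwdDiff (N : ℤ))^[r] ((fwdDiff (N : ℤ))^[L] f) m = 0 := by
        intro r
        induction r with
        | zero => exact hn₀
        | succ r ih =>
          intro m hm
          rw [Function.iterate_succ_apply', fwdDiff, ih m hm, ih _ (by omega), sub_zero]
      exact this r _ hy
    have hterm : ∀ k, (C ((fwdDiff (N : ℤ))^[k] f (y n) / (k.factorial : ℂ)) *
        (descPochhammer ℂ k).comp (C (N : ℂ)⁻¹ * (X - C (y n : ℂ)))).eval (n : ℂ) =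
        j.choose k • (fwdDiff (N : ℤ))^[k] f (y n) := by
      intro k
      have hx : (N : ℂ)⁻¹ * ((n : ℂ) - (y n : ℂ)) = j := by
        have : (n : ℂ) = y n + j * N := by
          have := congrArg (Int.cast : ℤ → ℂ) hj
          push_cast at this
          simpa using this
        rw [this]
        field_simp
        ring
      rw [eval_mul, eval_C, eval_comp]
      simp only [eval_mul, eval_C, eval_sub, eval_X, hx, descPochhammer_eval_eq_descFactorial,
        Nat.descFactorial_eq_factorial_mul_choose, nsmul_eq_mul]
      have : (k.factorial : ℂ) ≠ 0 := by exact_mod_cast k.factorial_ne_zero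
      push_cast
      field_simp
    have hnewton := shift_eq_sum_fwdDiff_iter (h := (N : ℤ)) f j (y n)
    rw [← hj] at hnewton
    rw [hnewton, eval_finsetSum, Finset.sum_congr rfl fun k _ => hterm k]
    rcases le_total L (j + 1) with hl | hl
    · symm
      apply Finset.sum_subset (Finset.range_mono hl)
      intro k _ hk
      rw [hz k (by simpa using hk), smul_zero]
    · apply Finset.sum_subset (Finset.range_mono hl)
      intro k _ hk
      rw [Nat.choose_eq_zero_of_lt (by simpa using hk), zero_smul]

/-! ### Reading coefficients of a quasi-polynomial off its annihilators -/

namespace QuasiPolynomial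

/-- The polynomial with which `Q` agrees on the residue class of `n`. -/
noncomputable def toPoly (Q : QuasiPolynomial) (n : ℤ) : ℂ[X] :=
  Q.coeff.sum fun i a => monomial i (a n)

theorem coeff_toPoly (Q : QuasiPolynomial) (n : ℤ) (i : ℕ) :
    (Q.toPoly n).coeff i = Q.coeff i n := by
  rw [toPoly, Finsupp.sum, finsetSum_coeff]
  simp only [coeff_monomial, Finset.sum_ite_eq']
  split_ifs with h
  · rfl
  · rw [Finsupp.notMem_support_iff.mp h]
    rfl

theorem eval_toPoly (Q : QuasiPolynomial) (n : ℤ) : (Q.toPoly n).eval (n : ℂ) = Q.eval n := by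
  rw [toPoly, Finsupp.sum, eval_finsetSum]
  simp [eval, Finsupp.sum]

theorem periodic_period (Q : QuasiPolynomial) (i : ℕ) :
    Function.Periodic (Q.coeff i) (Q.period : ℤ) :=
  Q.isLeast_period.1.2 i

theorem period_pos (Q : QuasiPolynomial) : 0 < Q.period := Q.isLeast_period.1.1

theorem toPoly_periodic (Q : QuasiPolynomial) : Function.Periodic Q.toPoly (Q.period : ℤ) := by
  intro n
  ext i
  rw [coeff_toPoly, coeff_toPoly, Q.periodic_period i n]

theorem ext_toPoly {Q Q' : QuasiPolynomial} (h : ∀ n, Q.toPoly n = Q'.toPoly n) : Q = Q' := by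
  ext i n
  rw [← coeff_toPoly, h, coeff_toPoly]

/-- Along a progression whose step is a common period, both sides are values of fixed polynomials
that agree at infinitely many points. -/
theorem eq_of_eventuallyEq {Q Q' : QuasiPolynomial}
    (h : ∀ᶠ n in atTop, Q.eval n = Q'.eval n) : Q = Q' := by
  refine ext_toPoly fun n => ?_
  obtain ⟨n₀, hn₀⟩ := eventually_atTop.mp h
  have hp : (0 : ℤ) < Q.period * Q'.period := by
    exact_mod_cast Nat.mul_pos Q.period_pos Q'.period_pos
  have h1 : ∀ k : ℕ, Q.toPoly (n + k * (Q.period * Q'.period)) = Q.toPoly n := fun k => by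
    have := Q.toPoly_periodic.nat_mul (k * Q'.period) n
    rw [← this]
    push_cast
    ring_nf
  have h2 : ∀ k : ℕ, Q'.toPoly (n + k * (Q.period * Q'.period)) = Q'.toPoly n := fun k => by
    have := Q'.toPoly_periodic.nat_mul (k * Q.period) n
    rw [← this]
    push_cast
    ring_nf
  refine Polynomial.eq_of_infinite_eval_eq _ _ (Set.Infinite.mono
    (s := (fun k : ℕ => ((n + k * (Q.period * Q'.period) : ℤ) : ℂ)) '' Set.Ici (n₀ - n).toNat)
    ?_ ?_)
  · rintro _ ⟨k, hk, rfl⟩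
    have hk' : n₀ - n ≤ k := by
      simp only [Set.mem_Ici] at hk
      omega
    have := hn₀ (n + k * (Q.period * Q'.period)) (by nlinarith)
    rw [← eval_toPoly, ← eval_toPoly, h1, h2] at this
    exact this
  · refine (Set.Ici_infinite _).image fun a _ b _ hab => ?_
    have hab' : n + a * (Q.period * Q'.period : ℤ) = n + b * (Q.period * Q'.period) := by
      exact_mod_cast hab
    have := mul_right_cancel₀ hp.ne' (add_left_cancel hab')
    exact_mod_cast this

/-- The quasi-polynomial given by a periodic family of polynomials of bounded degree. -/
noncomputable def ofPoly {N : ℕ} (hN : 0 < N) {L : ℕ} (P : ℤ → ℂ[X])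
    (hP : Function.Periodic P (N : ℤ)) (hd : ∀ n, (P n).degree < L) : QuasiPolynomial where
  coeff := Finsupp.onFinset (Finset.range L) (fun i n => (P n).coeff i) fun i hi => by
    by_contra h
    refine hi (funext fun n => ?_)
    exact coeff_eq_zero_of_degree_lt
      ((hd n).trans_le (by exact_mod_cast (by simpa using h : L ≤ i)))
  exists_periodic i := ⟨N, hN, fun n => by
    change (P (n + N)).coeff i = (P n).coeff i
    rw [hP n]⟩

theorem coeff_ofPoly {N : ℕ} (hN : 0 < N) {L : ℕ} (P : ℤ → ℂ[X])
    (hP : Function.Periodic P (N : ℤ)) (hd : ∀ n, (P n).degree < L) (i : ℕ) (n : ℤ) :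
    (ofPoly hN P hP hd).coeff i n = (P n).coeff i := rfl

theorem toPoly_ofPoly {N : ℕ} (hN : 0 < N) {L : ℕ} (P : ℤ → ℂ[X])
    (hP : Function.Periodic P (N : ℤ)) (hd : ∀ n, (P n).degree < L) (n : ℤ) :
    (ofPoly hN P hP hd).toPoly n = P n := by
  ext i
  rw [coeff_toPoly, coeff_ofPoly]

theorem exists_of_annihilates {N L : ℕ} (hN : 0 < N) {f : ℤ → ℂ}
    (h : Annihilates ((X ^ N - 1) ^ L) f) :
    ∃ Q : QuasiPolynomial, (∀ i, Function.Periodic (Q.coeff i) (N : ℤ)) ∧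
      (∀ i, L ≤ i → Q.coeff i = 0) ∧ ∀ᶠ n in atTop, Q.eval n = f n := by
  obtain ⟨P, hP, hd, hf⟩ := h.exists_polynomial hN
  refine ⟨ofPoly hN P hP hd, fun i n => ?_, fun i hi => funext fun n => ?_, ?_⟩
  · rw [coeff_ofPoly, coeff_ofPoly, hP n]
  · rw [coeff_ofPoly]
    exact coeff_eq_zero_of_degree_lt ((hd n).trans_le (by exact_mod_cast hi))
  · filter_upwards [hf] with n hn
    rw [hn, ← eval_toPoly, toPoly_ofPoly]

theorem exists_annihilates (Q : QuasiPolynomial) :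
    ∃ L : ℕ, Annihilates ((X ^ Q.period - 1) ^ L) Q.eval := by
  refine ⟨Q.coeff.support.sup id + 1, ?_⟩
  have h : Q.eval = ∑ i ∈ Q.coeff.support, fun n : ℤ => Q.coeff i n * (n : ℂ) ^ i := by
    ext n
    simp [eval, Finsupp.sum]
  rw [Annihilates, h, map_sum]
  refine Submodule.sum_mem _ fun i hi => ?_
  rw [annihilates_X_pow_sub_one_pow_of_periodic (Q.periodic_period i) i
    (Nat.lt_succ_of_le (Finset.le_sup (f := id) hi))]
  exact Submodule.zero_mem _

/-- Some power of `X ^ Q.period - 1` also kills `Q`. It is coprime to `g`, so `g` can be cancelled,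
and what remains bounds the degree. -/
theorem coeff_eq_zero_of_annihilates {Q : QuasiPolynomial} {e : ℕ} {g : ℂ[X]}
    (hg : IsCoprime g (X ^ Q.period - 1))
    (h : Annihilates (g * (X ^ Q.period - 1) ^ e) Q.eval) {i : ℕ} (hi : e ≤ i) :
    Q.coeff i = 0 := by
  obtain ⟨L, hL⟩ := Q.exists_annihilates
  obtain ⟨Q', -, hQ', hev⟩ := exists_of_annihilates Q.period_pos
    (Annihilates.of_mul_isCoprime (hg.pow_right (n := L)) h
      (hL.of_dvd (Dvd.intro _ rfl)))
  rw [← eq_of_eventuallyEq hev]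
  exact hQ' i hi

theorem exists_coeff_eq_of_annihilates {Q : QuasiPolynomial} {e : ℕ} {g : ℂ[X]}
    (hg : IsCoprime g (∑ j ∈ Finset.range Q.period, X ^ j))
    (h : Annihilates (g * (X ^ Q.period - 1) ^ e) Q.eval) {i : ℕ} (hi : e ≤ i) :
    ∃ c : ℂ, ∀ n, Q.coeff i n = c := by
  set Φ : ℂ[X] := ∑ j ∈ Finset.range Q.period, X ^ j with hΦ
  have hfac : (X ^ Q.period - 1 : ℂ[X]) = (X - 1) * Φ := (mul_geom_sum X _).symm
  have hcop : IsCoprime (X - 1 : ℂ[X]) Φ := by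
    rw [← C_1, (irreducible_X_sub_C (1 : ℂ)).coprime_iff_not_dvd, dvd_iff_isRoot, IsRoot.def]
    simpa [hΦ, eval_finsetSum] using Q.period_pos.ne'
  obtain ⟨L, hL⟩ := Q.exists_annihilates
  -- `g` may vanish at `1`, so it is cancelled only against `Φ ^ L`. The exponent of `X - 1` is
  -- allowed to grow to `L + e`, which is harmless because the root `1` gives constant coefficients.
  have h1 : Annihilates ((X - 1) ^ (L + e) * Φ ^ e) Q.eval := by
    refine Annihilates.of_mul_isCoprime (hg.pow_right (n := L)) (h.of_dvd ?_)
      (hL.of_dvd ?_)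
    · rw [hfac, mul_pow]
      exact ⟨(X - 1) ^ L, by ring⟩
    · rw [hfac, mul_pow]
      exact ⟨(X - 1) ^ e * Φ ^ e, by ring⟩
  -- `u` is eventually an ordinary polynomial, and `v` is eventually a quasi-polynomial of degree
  -- below `e`. Coefficients from `e` on therefore come from `u` alone.
  obtain ⟨u, v, huv, hu, hv⟩ := Annihilates.exists_add_of_isCoprime hcop.pow h1
  obtain ⟨Q₁, hp₁, -, he₁⟩ := exists_of_annihilates (N := 1) one_pos (by simpa using hu)
  obtain ⟨Q₂, -, hc₂, he₂⟩ := exists_of_annihilates (L := e) Q.period_pos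
    (hv.of_dvd (by rw [hfac]; exact pow_dvd_pow_of_dvd (Dvd.intro_left _ rfl) e))
  have hpoly : ∀ n, Q.toPoly n = Q₁.toPoly n + Q₂.toPoly n := by
    let P : ℤ → ℂ[X] := fun n => Q₁.toPoly n + Q₂.toPoly n
    have hP : Function.Periodic P ((Q₁.period * Q₂.period : ℕ) : ℤ) := fun n => by
      have h1 := Q₁.toPoly_periodic.nat_mul Q₂.period n
      have h2 := Q₂.toPoly_periodic.nat_mul Q₁.period n
      simp only [P]
      rw [← h1, ← h2]
      push_cast
      ring_nf
    let B : ℕ := Q₁.coeff.support.sup id + Q₂.coeff.support.sup id + 1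
    have hB : ∀ n, (P n).degree < B := fun n => by
      rw [degree_lt_iff_coeff_zero]
      intro m hm
      have key : ∀ Q' : QuasiPolynomial, Q'.coeff.support.sup id < m → Q'.coeff m n = 0 := by
        intro Q' hQ'
        have : m ∉ Q'.coeff.support := fun h => by
          have h2 : m ≤ Q'.coeff.support.sup id := Finset.le_sup (f := id) h
          omega
        rw [Finsupp.notMem_support_iff.mp this]
        rfl
      rw [coeff_add, coeff_toPoly, coeff_toPoly, key Q₁ (by omega), key Q₂ (by omega), add_zero]
    have : Q = ofPoly (Nat.mul_pos Q₁.period_pos Q₂.period_pos) P hP hB := by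
      refine eq_of_eventuallyEq ?_
      filter_upwards [he₁, he₂] with n h1 h2
      rw [← eval_toPoly (ofPoly _ P hP hB), toPoly_ofPoly, eval_add, eval_toPoly, eval_toPoly,
        h1, h2, huv, Pi.add_apply]
    intro n
    rw [this, toPoly_ofPoly]
  refine ⟨Q₁.coeff i 0, fun n => ?_⟩
  rw [← coeff_toPoly, hpoly, coeff_add, coeff_toPoly, coeff_toPoly, hc₂ i hi, Pi.zero_apply,
    add_zero]
  simpa using (hp₁ i).int_mul n 0

end QuasiPolynomial

/-! ### Coprimality of the factors `X ^ d - 1` -/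

/-- A common root satisfies `a ^ d = a ^ q = 1`, hence `a = 1`, where the sum equals `q ≠ 0`. -/
theorem X_pow_sub_one_isCoprime_geom_sum {d q : ℕ} (hd : d.Coprime q) (hq : 0 < q) :
    IsCoprime (X ^ d - 1 : ℂ[X]) (∑ j ∈ Finset.range q, X ^ j) := by
  rw [Polynomial.isCoprime_iff_aeval_ne_zero_of_isAlgClosed ℂ ℂ]
  intro a
  by_contra! h
  obtain ⟨h1, h2⟩ := h
  have h1' : a ^ d = 1 := by simpa [sub_eq_zero] using h1
  have h2' : ∑ j ∈ Finset.range q, a ^ j = 0 := by simpa using h2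
  have h3 : a ^ q = 1 := by
    have := mul_geom_sum a q
    rw [h2', mul_zero] at this
    exact (sub_eq_zero.mp this.symm)
  have h4 : a = 1 := by
    have := pow_gcd_eq_one.mpr ⟨h1', h3⟩
    rwa [hd.gcd_eq_one, pow_one] at this
  rw [h4] at h2'
  simp at h2'
  omega

/-- Take `g` to be `X ^ d - 1` divided by its gcd with `X ^ q - 1`. Since `X ^ d - 1` is squarefree,
`g` shares no further factor with `X ^ q - 1`. -/
theorem exists_isCoprime_dvd_X_pow_sub_one_mul {d : ℕ} (hd : 0 < d) (q : ℕ) :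
    ∃ g : ℂ[X], IsCoprime g (X ^ q - 1) ∧ (X ^ d - 1 : ℂ[X]) ∣ g * (X ^ q - 1) := by
  have hsq : Squarefree (X ^ d - 1 : ℂ[X]) :=
    (X_pow_sub_one_separable_iff.mpr (by exact_mod_cast hd.ne')).squarefree
  obtain ⟨g, hg⟩ := EuclideanDomain.gcd_dvd_left (X ^ d - 1 : ℂ[X]) (X ^ q - 1)
  refine ⟨g, ?_, ?_⟩
  · rw [← EuclideanDomain.gcd_isUnit_iff]
    apply hsq
    set r := EuclideanDomain.gcd g (X ^ q - 1 : ℂ[X])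
    have h1 : r ∣ g := EuclideanDomain.gcd_dvd_left _ _
    have h2 : r ∣ X ^ q - 1 := EuclideanDomain.gcd_dvd_right _ _
    have h3 : r ∣ X ^ d - 1 := h1.trans (hg ▸ Dvd.intro_left _ rfl)
    rw [hg]
    exact mul_dvd_mul (EuclideanDomain.dvd_gcd h3 h2) h1
  · nth_rw 1 [hg]
    rw [mul_comm]
    exact mul_dvd_mul_left g (EuclideanDomain.gcd_dvd_right _ _)

/-! ### Dimensions along a linear map -/

section LinearAlgebra

variable {K V W : Type*} [Field K] [AddCommGroup V] [Module K V] [AddCommGroup W] [Module K W]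

/-- For `g : W → V` and `U ≤ V`, the cokernel of `W / g⁻¹ U → V / U` is `V / (U + im g)`. -/
noncomputable def quotientRangeEquiv (g : W →ₗ[K] V) (U : Submodule K V) :
    ((V ⧸ U) ⧸ LinearMap.range (U.mkQ ∘ₗ g)) ≃ₗ[K] V ⧸ (U ⊔ LinearMap.range g) :=
  (Submodule.quotEquivOfEq _ _ (LinearMap.range_comp g U.mkQ)).trans
    (Submodule.quotientQuotientEquivQuotientSup U (LinearMap.range g))

/-- For `g : W → V` and `U ≤ V`, the image of `W` in `V / U` is `W / g⁻¹ U`. -/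
noncomputable def quotientComapEquiv (g : W →ₗ[K] V) (U : Submodule K V) :
    (W ⧸ U.comap g) ≃ₗ[K] LinearMap.range (U.mkQ ∘ₗ g) :=
  (Submodule.quotEquivOfEq _ _ (by rw [LinearMap.ker_comp, Submodule.ker_mkQ])).trans
    (U.mkQ ∘ₗ g).quotKerEquivRange

theorem finite_quotient_of_comap_of_sup (g : W →ₗ[K] V) (U : Submodule K V)
    (h₁ : Module.Finite K (W ⧸ U.comap g))
    (h₂ : Module.Finite K (V ⧸ (U ⊔ LinearMap.range g))) : Module.Finite K (V ⧸ U) := by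
  have := Module.Finite.equiv (quotientComapEquiv g U)
  have := Module.Finite.equiv (quotientRangeEquiv g U).symm
  exact Module.Finite.of_submodule_quotient (LinearMap.range (U.mkQ ∘ₗ g))

theorem finrank_quotient_eq_add (g : W →ₗ[K] V) (U : Submodule K V) [Module.Finite K (V ⧸ U)] :
    Module.finrank K (V ⧸ U) = Module.finrank K (W ⧸ U.comap g) +
      Module.finrank K (V ⧸ (U ⊔ LinearMap.range g)) := by
  rw [(quotientComapEquiv g U).finrank_eq, ← (quotientRangeEquiv g U).finrank_eq, add_comm,
    Submodule.finrank_quotient_add_finrank]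

end LinearAlgebra

/-! ### Krull dimension of quotient modules -/

section SupportDim

variable {R M : Type*} [CommRing R] [AddCommGroup M] [Module R M]

open Pointwise

theorem supportDim_quotient_anti {N N' : Submodule R M} (h : N ≤ N') :
    Module.supportDim R (M ⧸ N') ≤ Module.supportDim R (M ⧸ N) :=
  Module.supportDim_le_of_surjective (Submodule.factor h) (Submodule.factor_surjective h)

/-- An element injective on `M / N` avoids the minimal primes of its support, so dividing by it
lowers the dimension. -/
theorem supportDim_quotient_sup_smul_top_succ_le [Module.Finite R M] {N : Submodule R M} {x : R}
    (hx : ∀ m, x • m ∈ N → m ∈ N) :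
    Module.supportDim R (M ⧸ (N ⊔ x • (⊤ : Submodule R M))) + 1 ≤
      Module.supportDim R (M ⧸ N) := by
  have hreg : IsSMulRegular (M ⧸ N) x := by
    rw [isSMulRegular_iff_right_eq_zero_of_smul]
    intro m hm
    induction m using Submodule.Quotient.induction_on with
    | H m =>
      rw [← Submodule.Quotient.mk_smul, Submodule.Quotient.mk_eq_zero] at hm
      exact (Submodule.Quotient.mk_eq_zero N).mpr (hx m hm)
  refine le_trans ?_ (Module.supportDim_quotSMulTop_succ_le_of_notMem_minimalPrimes (x := x)
    fun p hp => hreg.notMem_of_mem_minimalPrimes hp)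
  gcongr
  have hle : x • (⊤ : Submodule R (M ⧸ N)) ≤
      LinearMap.ker (Submodule.factor (le_sup_left : N ≤ N ⊔ x • (⊤ : Submodule R M))) := by
    intro m hm
    obtain ⟨m, -, rfl⟩ := (Submodule.mem_smul_pointwise_iff_exists _ _ _).mp hm
    induction m using Submodule.Quotient.induction_on with
    | H m =>
      rw [LinearMap.mem_ker, ← Submodule.Quotient.mk_smul]
      exact (Submodule.Quotient.mk_eq_zero _).mpr
        (Submodule.mem_sup_right (Submodule.smul_mem_pointwise_smul m x ⊤ trivial))
  refine Module.supportDim_le_of_surjective (Submodule.liftQ _ _ hle) ?_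
  rw [← LinearMap.range_eq_top, Submodule.range_liftQ, LinearMap.range_eq_top]
  exact Submodule.factor_surjective _

theorem ringKrullDim_lt_top_of_finiteType (K : Type*) [Field K] [Algebra K R]
    [Algebra.FiniteType K R] : ringKrullDim R < ⊤ := by
  obtain ⟨n, f, hf⟩ := Algebra.FiniteType.iff_quotient_mvPolynomial''.mp
    (inferInstance : Algebra.FiniteType K R)
  refine (ringKrullDim_le_of_surjective f.toRingHom hf).trans_lt ?_
  rw [MvPolynomial.ringKrullDim_of_isNoetherianRing, ringKrullDim_eq_zero_of_field, zero_add,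
    Nat.card_eq_fintype_card, Fintype.card_fin]
  exact WithBot.coe_lt_coe.mpr (ENat.natCast_lt_top n)

theorem exists_supportDim_eq (K : Type*) [Field K] [Algebra K R] [Algebra.FiniteType K R]
    [Nontrivial M] : ∃ e : ℕ, Module.supportDim R M = (e : WithBot ℕ∞) := by
  have h := (Module.supportDim_le_ringKrullDim R M).trans_lt (ringKrullDim_lt_top_of_finiteType K)
  obtain ⟨a, ha⟩ := WithBot.ne_bot_iff_exists.mp (Module.supportDim_ne_bot_of_nontrivial R M)
  rw [← ha] at h ⊢
  have h' : a < ⊤ := WithBot.coe_lt_coe.mp h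
  exact ⟨a.toNat, by rw [← WithBot.coe_natCast, ENat.natCast_toNat h'.ne]⟩

end SupportDim

/-! ### Graded modules and homogeneous submodules -/

section Graded

variable {K R M : Type*} [Field K] [CommRing R] [Algebra K R]
  (𝒜 : ℕ → Submodule K R)
  [AddCommGroup M] [Module K M] [Module R M]
  (ℳ : ℤ → Submodule K M)

/-- The projection to the homogeneous component of degree `n`. -/
noncomputable def gradedComponent [DirectSum.Decomposition ℳ] (n : ℤ) : M →ₗ[K] M :=
  (ℳ n).subtype ∘ₗ DirectSum.component K ℤ (fun i => ℳ i) n ∘ₗ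
    (DirectSum.decomposeLinearEquiv ℳ).toLinearMap

section Component

variable [DirectSum.Decomposition ℳ]

theorem gradedComponent_mem (n : ℤ) (m : M) : gradedComponent ℳ n m ∈ ℳ n :=
  (DirectSum.decompose ℳ m n).2

theorem gradedComponent_of_mem {n : ℤ} {m : M} (hm : m ∈ ℳ n) : gradedComponent ℳ n m = m :=
  DirectSum.decompose_of_mem_same ℳ hm

theorem gradedComponent_of_mem_ne {k n : ℤ} {m : M} (hm : m ∈ ℳ k) (h : k ≠ n) :
    gradedComponent ℳ n m = 0 :=
  DirectSum.decompose_of_mem_ne ℳ hm h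

theorem mem_of_gradedComponent_mem (N : Submodule K M) {m : M}
    (h : ∀ n, gradedComponent ℳ n m ∈ N) : m ∈ N := by
  classical
  rw [← DirectSum.sum_support_decompose ℳ m]
  exact Submodule.sum_mem _ fun n _ => h n

theorem gradedComponent_smul
    (hℳ : ∀ (i : ℕ) (j : ℤ) (r : R) (m : M), r ∈ 𝒜 i → m ∈ ℳ j → r • m ∈ ℳ ((i : ℤ) + j))
    {i : ℕ} {r : R} (hr : r ∈ 𝒜 i) (j : ℤ) (m : M) :
    gradedComponent ℳ (i + j) (r • m) = r • gradedComponent ℳ j m := by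
  induction m using DirectSum.Decomposition.inductionOn ℳ with
  | zero => simp
  | @homogeneous k m =>
    by_cases h : k = j
    · subst h
      rw [gradedComponent_of_mem ℳ m.2, gradedComponent_of_mem ℳ (hℳ i k r m hr m.2)]
    · rw [gradedComponent_of_mem_ne ℳ m.2 h,
        gradedComponent_of_mem_ne ℳ (hℳ i k r m hr m.2) (by omega), smul_zero]
  | add m m' h h' => rw [smul_add, map_add, h, h', map_add, smul_add]

theorem exists_gradedComponent_eq_zero (m : M) :
    ∃ b : ℕ, ∀ k : ℤ, b < k.natAbs → gradedComponent ℳ k m = 0 := by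
  induction m using DirectSum.Decomposition.inductionOn ℳ with
  | zero => exact ⟨0, by simp⟩
  | @homogeneous i m =>
    refine ⟨i.natAbs, fun k hk => gradedComponent_of_mem_ne ℳ m.2 ?_⟩
    rintro rfl
    omega
  | add m m' h h' =>
    obtain ⟨b, hb⟩ := h
    obtain ⟨b', hb'⟩ := h'
    refine ⟨max b b', fun k hk => ?_⟩
    rw [map_add, hb k (by omega), hb' k (by omega), add_zero]

theorem exists_gradedComponent_eq_zero_finset (s : Finset M) :
    ∃ b : ℕ, ∀ m ∈ s, ∀ k : ℤ, b < k.natAbs → gradedComponent ℳ k m = 0 := by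
  choose b hb using exists_gradedComponent_eq_zero ℳ
  refine ⟨s.sup b, fun m hm k hk => hb m k ((Finset.le_sup hm).trans_lt hk)⟩

/-- The ring has no negative degrees, so nothing lies below the lowest degree occurring in a finite
set of generators. -/
theorem exists_eq_bot_of_finite [GradedAlgebra 𝒜] [Module.Finite R M]
    (hℳ : ∀ (i : ℕ) (j : ℤ) (r : R) (m : M), r ∈ 𝒜 i → m ∈ ℳ j → r • m ∈ ℳ ((i : ℤ) + j)) :
    ∃ n₀ : ℤ, ∀ n < n₀, ℳ n = ⊥ := by
  obtain ⟨s, hs⟩ := (Module.Finite.fg_top : (⊤ : Submodule R M).FG)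
  obtain ⟨b, hb⟩ := exists_gradedComponent_eq_zero_finset ℳ s
  have key : ∀ m ∈ Submodule.span R (s : Set M), ∀ k < -(b : ℤ), gradedComponent ℳ k m = 0 := by
    intro m hm
    induction hm using Submodule.span_induction with
    | mem m hm =>
      intro k hk
      exact hb m hm k (by omega)
    | zero => simp
    | add m m' _ _ h h' =>
      intro k hk
      rw [map_add, h k hk, h' k hk, add_zero]
    | smul r m _ h =>
      induction r using DirectSum.Decomposition.inductionOn 𝒜 with
      | zero => simp
      | @homogeneous i r =>
        intro k hk
        have := gradedComponent_smul 𝒜 ℳ hℳ r.2 (k - i) m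
        rw [add_sub_cancel] at this
        rw [this, h _ (by omega), smul_zero]
      | add r r' hr hr' =>
        intro k hk
        rw [add_smul, map_add, hr k hk, hr' k hk, add_zero]
  refine ⟨-(b : ℤ), fun n hn => (Submodule.eq_bot_iff _).mpr fun m hm => ?_⟩
  rw [← gradedComponent_of_mem ℳ hm]
  exact key m (hs ▸ trivial) n hn

/-- A submodule is homogeneous if it contains the homogeneous components of its elements. -/
def IsHomogeneousSubmodule (N : Submodule R M) : Prop :=
  ∀ m ∈ N, ∀ n, gradedComponent ℳ n m ∈ N

open Pointwise

variable {𝒜 ℳ} in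
theorem IsHomogeneousSubmodule.comap_lsmul
    (hℳ : ∀ (i : ℕ) (j : ℤ) (r : R) (m : M), r ∈ 𝒜 i → m ∈ ℳ j → r • m ∈ ℳ ((i : ℤ) + j))
    {N : Submodule R M} (hN : IsHomogeneousSubmodule ℳ N) {i : ℕ} {x : R} (hx : x ∈ 𝒜 i) :
    IsHomogeneousSubmodule ℳ (N.comap (LinearMap.lsmul R M x)) := by
  intro m hm n
  change x • _ ∈ N
  rw [← gradedComponent_smul 𝒜 ℳ hℳ hx]
  exact hN _ hm _

variable {𝒜 ℳ} in
theorem IsHomogeneousSubmodule.sup_smul_top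
    (hℳ : ∀ (i : ℕ) (j : ℤ) (r : R) (m : M), r ∈ 𝒜 i → m ∈ ℳ j → r • m ∈ ℳ ((i : ℤ) + j))
    {N : Submodule R M} (hN : IsHomogeneousSubmodule ℳ N) {i : ℕ} {x : R} (hx : x ∈ 𝒜 i) :
    IsHomogeneousSubmodule ℳ (N ⊔ x • (⊤ : Submodule R M)) := by
  intro m hm n
  obtain ⟨a, ha, b, hb, rfl⟩ := Submodule.mem_sup.mp hm
  obtain ⟨b, -, rfl⟩ := (Submodule.mem_smul_pointwise_iff_exists _ _ _).mp hb
  rw [map_add]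
  have := gradedComponent_smul 𝒜 ℳ hℳ hx (n - i) b
  rw [add_sub_cancel] at this
  rw [this]
  exact Submodule.add_mem_sup (hN a ha n) (Submodule.smul_mem_pointwise_smul _ x ⊤ trivial)

variable [IsScalarTower K R M]

/-- A graded form of Nakayama's lemma. -/
theorem sup_span_smul_top_ne_top [GradedAlgebra 𝒜] [Module.Finite R M]
    (hℳ : ∀ (i : ℕ) (j : ℤ) (r : R) (m : M), r ∈ 𝒜 i → m ∈ ℳ j → r • m ∈ ℳ ((i : ℤ) + j))
    {N : Submodule R M} (hN : IsHomogeneousSubmodule ℳ N) (hne : N ≠ ⊤) {s : Set R}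
    (hs : ∀ x ∈ s, ∃ i : ℕ, 0 < i ∧ x ∈ 𝒜 i) :
    N ⊔ Ideal.span s • (⊤ : Submodule R M) ≠ ⊤ := by
  obtain ⟨n₀, hn₀⟩ := exists_eq_bot_of_finite 𝒜 ℳ hℳ
  have hex : ∃ k : ℕ, ∃ m ∈ ℳ (n₀ + k), m ∉ N := by
    by_contra! h
    refine hne (eq_top_iff.mpr fun m _ =>
      mem_of_gradedComponent_mem ℳ (N.restrictScalars K) fun n => ?_)
    rcases lt_or_ge n n₀ with hn | hn
    · have := gradedComponent_mem ℳ n m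
      rw [hn₀ n hn, Submodule.mem_bot] at this
      rw [this]
      exact Submodule.zero_mem _
    · refine h (n - n₀).toNat _ ?_
      rw [Int.toNat_of_nonneg (by omega), add_sub_cancel]
      exact gradedComponent_mem ℳ n m
  classical
  -- In the lowest degree where `N` misses something, components of elements of `Ideal.span s • ⊤`
  -- come from strictly lower degrees, hence lie in `N`.
  obtain ⟨m₀, hm₀, hm₀N⟩ := Nat.find_spec hex
  set k := Nat.find hex with hk
  have hmin : ∀ j < n₀ + k, ∀ m ∈ ℳ j, m ∈ N := by
    intro j hj m hm
    rcases lt_or_ge j n₀ with hn | hn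
    · rw [hn₀ j hn, Submodule.mem_bot] at hm
      rw [hm]
      exact Submodule.zero_mem _
    · by_contra hmN
      refine Nat.find_min hex (m := (j - n₀).toNat) (by omega) ⟨m, ?_, hmN⟩
      rwa [Int.toNat_of_nonneg (by omega), add_sub_cancel]
  have hspan : ∀ r ∈ Ideal.span s, ∀ m : M, gradedComponent ℳ (n₀ + k) (r • m) ∈ N := by
    intro r hr
    induction hr using Submodule.span_induction with
    | mem x hx =>
      intro m
      obtain ⟨i, hi, hxi⟩ := hs x hx
      have := gradedComponent_smul 𝒜 ℳ hℳ hxi (n₀ + k - i) m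
      rw [add_sub_cancel] at this
      rw [this]
      exact N.smul_mem x (hmin _ (by omega) _ (gradedComponent_mem ℳ _ m))
    | zero => simp
    | add x y _ _ h h' =>
      intro m
      rw [add_smul, map_add]
      exact N.add_mem (h m) (h' m)
    | smul a x _ h =>
      intro m
      rw [smul_eq_mul, mul_comm, mul_smul]
      exact h _
  intro htop
  refine hm₀N ?_
  have hmem : m₀ ∈ N ⊔ Ideal.span s • (⊤ : Submodule R M) := by
    rw [htop]
    trivial
  rw [← gradedComponent_of_mem ℳ hm₀]
  obtain ⟨a, ha, b, hb, hab⟩ := Submodule.mem_sup.mp hmem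
  rw [← hab, map_add]
  refine N.add_mem (hN a ha _) ?_
  refine Submodule.smul_induction_on hb (fun r hr m _ => hspan r hr m) fun x y hx hy => ?_
  rw [map_add]
  exact N.add_mem hx hy

end Component

variable [IsScalarTower K R M]

/-- The degree `n` part of a submodule. -/
def gradedPiece (N : Submodule R M) (n : ℤ) : Submodule K (ℳ n) :=
  (N.restrictScalars K).comap (ℳ n).subtype

theorem mem_gradedPiece {N : Submodule R M} {n : ℤ} {m : ℳ n} :
    m ∈ gradedPiece ℳ N n ↔ (m : M) ∈ N := Iff.rfl

/-- The Hilbert function of `M / N`, with complex values. -/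
noncomputable def hilbertFun (N : Submodule R M) (n : ℤ) : ℂ :=
  Module.finrank K (ℳ n ⧸ gradedPiece ℳ N n)

/-- Multiplication by a homogeneous element on a graded piece. -/
noncomputable def gradedMul
    (hℳ : ∀ (i : ℕ) (j : ℤ) (r : R) (m : M), r ∈ 𝒜 i → m ∈ ℳ j → r • m ∈ ℳ ((i : ℤ) + j))
    {i : ℕ} {x : R} (hx : x ∈ 𝒜 i) (j : ℤ) : ℳ j →ₗ[K] ℳ (i + j) :=
  ((LinearMap.lsmul R M x).restrictScalars K).restrict fun m hm => hℳ i j x m hx hm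

variable {𝒜}

theorem comap_gradedMul
    (hℳ : ∀ (i : ℕ) (j : ℤ) (r : R) (m : M), r ∈ 𝒜 i → m ∈ ℳ j → r • m ∈ ℳ ((i : ℤ) + j))
    {i : ℕ} {x : R} (hx : x ∈ 𝒜 i) (j : ℤ) (N : Submodule R M) :
    (gradedPiece ℳ N (i + j)).comap (gradedMul 𝒜 ℳ hℳ hx j) =
      gradedPiece ℳ (N.comap (LinearMap.lsmul R M x)) j := rfl

open Pointwise

variable {ℳ} in
theorem IsHomogeneousSubmodule.gradedPiece_sup_range [DirectSum.Decomposition ℳ]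
    (hℳ : ∀ (i : ℕ) (j : ℤ) (r : R) (m : M), r ∈ 𝒜 i → m ∈ ℳ j → r • m ∈ ℳ ((i : ℤ) + j))
    {N : Submodule R M} (hN : IsHomogeneousSubmodule ℳ N)
    {i : ℕ} {x : R} (hx : x ∈ 𝒜 i) (j : ℤ) :
    gradedPiece ℳ N (i + j) ⊔ LinearMap.range (gradedMul 𝒜 ℳ hℳ hx j) =
      gradedPiece ℳ (N ⊔ x • (⊤ : Submodule R M)) (i + j) := by
  refine le_antisymm (sup_le (fun m hm => Submodule.mem_sup_left hm) ?_) ?_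
  · rintro _ ⟨m, rfl⟩
    exact Submodule.mem_sup_right (Submodule.smul_mem_pointwise_smul (m : M) x ⊤ trivial)
  · rintro ⟨v, hv⟩ hm
    obtain ⟨a, ha, b, hb, hab⟩ := Submodule.mem_sup.mp (mem_gradedPiece ℳ |>.mp hm)
    obtain ⟨b, -, rfl⟩ := (Submodule.mem_smul_pointwise_iff_exists _ _ _).mp hb
    refine Submodule.mem_sup.mpr ⟨⟨_, gradedComponent_mem ℳ (i + j) a⟩, hN a ha _, _,
      ⟨⟨_, gradedComponent_mem ℳ j b⟩, rfl⟩, Subtype.ext ?_⟩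
    change gradedComponent ℳ (i + j) a + x • gradedComponent ℳ j b = v
    rw [← gradedComponent_smul 𝒜 ℳ hℳ hx, ← map_add, hab, gradedComponent_of_mem ℳ hv]

end Graded

/-! ### Hilbert functions and the induction on submodules -/

section Hilbert

open Pointwise

variable {K R M : Type*} [Field K] [CommRing R] [Algebra K R]
  {𝒜 : ℕ → Submodule K R} [GradedAlgebra 𝒜]
  [AddCommGroup M] [Module K M] [Module R M] [IsScalarTower K R M] [Module.Finite R M]
  {ℳ : ℤ → Submodule K M} [DirectSum.Decomposition ℳ]

omit [Module.Finite R M] in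
-- If all elements of positive degree kill `M / N`, then `R` acts on it through `K`.
theorem exists_smul_sub_smul_mem (h𝒜 : (𝒜 0 : Set R) = Set.range (algebraMap K R))
    {N : Submodule R M} (hN : ∀ i : ℕ, 0 < i → ∀ x ∈ 𝒜 i, ∀ m : M, x • m ∈ N) (r : R) :
    ∃ c : K, ∀ m : M, r • m - c • m ∈ N := by
  induction r using DirectSum.Decomposition.inductionOn 𝒜 with
  | zero => exact ⟨0, by simp⟩
  | @homogeneous i r =>
    rcases Nat.eq_zero_or_pos i with rfl | hi
    · obtain ⟨c, hc⟩ : (r : R) ∈ Set.range (algebraMap K R) := h𝒜 ▸ r.2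
      exact ⟨c, fun m => by rw [← hc, algebraMap_smul, sub_self]; exact N.zero_mem⟩
    · exact ⟨0, fun m => by rw [zero_smul, sub_zero]; exact hN i hi r r.2 m⟩
  | add r r' h h' =>
    obtain ⟨c, hc⟩ := h
    obtain ⟨c', hc'⟩ := h'
    refine ⟨c + c', fun m => ?_⟩
    rw [add_smul, add_smul, add_sub_add_comm]
    exact N.add_mem (hc m) (hc' m)

theorem exists_finset_span_sup_eq_top (h𝒜 : (𝒜 0 : Set R) = Set.range (algebraMap K R))
    {N : Submodule R M} (hN : ∀ i : ℕ, 0 < i → ∀ x ∈ 𝒜 i, ∀ m : M, x • m ∈ N) :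
    ∃ s : Finset M, Submodule.span K (s : Set M) ⊔ N.restrictScalars K = ⊤ := by
  obtain ⟨s, hs⟩ := (Module.Finite.fg_top : (⊤ : Submodule R M).FG)
  refine ⟨s, eq_top_iff.mpr fun m _ => ?_⟩
  have hm : m ∈ Submodule.span R (s : Set M) := hs ▸ trivial
  induction hm using Submodule.span_induction with
  | mem m hm => exact Submodule.mem_sup_left (Submodule.subset_span hm)
  | zero => exact Submodule.zero_mem _
  | add m m' _ _ h h' => exact Submodule.add_mem _ (h trivial) (h' trivial)
  | smul r m _ h =>
    obtain ⟨c, hc⟩ := exists_smul_sub_smul_mem h𝒜 hN r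
    rw [← sub_add_cancel (r • m) (c • m)]
    exact Submodule.add_mem _ (Submodule.mem_sup_right (hc m))
      (Submodule.smul_mem _ c (h trivial))

omit [DirectSum.Decomposition ℳ] in
theorem finite_gradedPiece_of_forall_smul_mem
    (h𝒜 : (𝒜 0 : Set R) = Set.range (algebraMap K R))
    {N : Submodule R M} (hN : ∀ i : ℕ, 0 < i → ∀ x ∈ 𝒜 i, ∀ m : M, x • m ∈ N) (n : ℤ) :
    Module.Finite K (ℳ n ⧸ gradedPiece ℳ N n) := by
  obtain ⟨s, hs⟩ := exists_finset_span_sup_eq_top h𝒜 hN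
  have : Module.Finite K (M ⧸ N.restrictScalars K) := by
    refine Module.Finite.of_surjective
      ((N.restrictScalars K).mkQ ∘ₗ (Submodule.span K (s : Set M)).subtype) ?_
    rw [← LinearMap.range_eq_top, LinearMap.range_comp, Submodule.range_subtype,
      eq_top_iff, ← (N.restrictScalars K).range_mkQ, LinearMap.range_eq_map, ← hs,
      Submodule.map_sup]
    exact sup_le le_rfl (by rw [Submodule.mkQ_map_self]; exact bot_le)
  have hker : LinearMap.ker ((N.restrictScalars K).mkQ ∘ₗ (ℳ n).subtype) = gradedPiece ℳ N n := by
    rw [LinearMap.ker_comp, Submodule.ker_mkQ]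
    rfl
  exact Module.Finite.of_injective
    ((gradedPiece ℳ N n).liftQ ((N.restrictScalars K).mkQ ∘ₗ (ℳ n).subtype) hker.ge)
    (LinearMap.ker_eq_bot.mp (Submodule.ker_liftQ_eq_bot _ _ _ hker.le))

theorem hilbertFun_mem_eventuallyZero_of_forall_smul_mem
    (h𝒜 : (𝒜 0 : Set R) = Set.range (algebraMap K R))
    {N : Submodule R M} (hNh : IsHomogeneousSubmodule ℳ N)
    (hN : ∀ i : ℕ, 0 < i → ∀ x ∈ 𝒜 i, ∀ m : M, x • m ∈ N) :
    hilbertFun ℳ N ∈ eventuallyZero := by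
  obtain ⟨s, hs⟩ := exists_finset_span_sup_eq_top h𝒜 hN
  obtain ⟨b, hb⟩ := exists_gradedComponent_eq_zero_finset ℳ s
  refine eventually_atTop.mpr ⟨b + 1, fun n hn => ?_⟩
  have htop : gradedPiece ℳ N n = ⊤ := by
    refine eq_top_iff.mpr fun m _ => ?_
    have hm : (m : M) ∈ Submodule.span K (s : Set M) ⊔ N.restrictScalars K := hs ▸ trivial
    obtain ⟨u, hu, v, hv, huv⟩ := Submodule.mem_sup.mp hm
    have hu0 : gradedComponent ℳ n u = 0 := by
      have : Submodule.span K (s : Set M) ≤ LinearMap.ker (gradedComponent ℳ n) :=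
        Submodule.span_le.mpr fun m hm => hb m hm n (by omega)
      exact this hu
    rw [mem_gradedPiece, ← gradedComponent_of_mem ℳ m.2, ← huv, map_add, hu0, zero_add]
    exact hNh v hv n
  have : Subsingleton (ℳ n ⧸ gradedPiece ℳ N n) :=
    Submodule.Quotient.subsingleton_iff.mpr htop
  simp [hilbertFun, Module.finrank_zero_of_subsingleton]

omit [GradedAlgebra 𝒜] [IsScalarTower K R M] [Module.Finite R M] [DirectSum.Decomposition ℳ] in
theorem lt_sup_smul_top {N : Submodule R M} {x : R} {m : M} (h : x • m ∉ N) :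
    N < N ⊔ x • (⊤ : Submodule R M) :=
  lt_of_le_of_ne le_sup_left fun he => h (he ▸ Submodule.mem_sup_right
    (Submodule.smul_mem_pointwise_smul m x ⊤ trivial))

omit [GradedAlgebra 𝒜] [IsScalarTower K R M] [Module.Finite R M] [DirectSum.Decomposition ℳ] in
theorem le_comap_lsmul (N : Submodule R M) (x : R) : N ≤ N.comap (LinearMap.lsmul R M x) :=
  fun _ hm => N.smul_mem x hm

theorem finite_gradedPiece [IsNoetherianRing R]
    (h𝒜 : (𝒜 0 : Set R) = Set.range (algebraMap K R))
    (hℳ : ∀ (i : ℕ) (j : ℤ) (r : R) (m : M), r ∈ 𝒜 i → m ∈ ℳ j → r • m ∈ ℳ ((i : ℤ) + j))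
    (N : Submodule R M) (hN : IsHomogeneousSubmodule ℳ N) (n : ℤ) :
    Module.Finite K (ℳ n ⧸ gradedPiece ℳ N n) := by
  have : IsNoetherian R M := isNoetherian_of_isNoetherianRing_of_finite R M
  induction N using WellFoundedGT.induction generalizing n with
  | ind N ih =>
    by_cases hA : ∀ i : ℕ, 0 < i → ∀ x ∈ 𝒜 i, ∀ m : M, x • m ∈ N
    · exact finite_gradedPiece_of_forall_smul_mem h𝒜 hA n
    push Not at hA
    obtain ⟨i, hi, x, hx, m, hm⟩ := hA
    have step : ∀ j, Module.Finite K (ℳ j ⧸ gradedPiece ℳ (N.comap (LinearMap.lsmul R M x)) j) →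
        Module.Finite K (ℳ (i + j) ⧸ gradedPiece ℳ N (i + j)) := by
      intro j hj
      refine finite_quotient_of_comap_of_sup (gradedMul 𝒜 ℳ hℳ hx j) _ hj ?_
      rw [hN.gradedPiece_sup_range hℳ hx j]
      exact ih _ (lt_sup_smul_top hm) (hN.sup_smul_top hℳ hx) _
    rcases (le_comap_lsmul N x).lt_or_eq with hlt | heq
    · have := step (n - i) (ih _ hlt (hN.comap_lsmul hℳ hx) _)
      rwa [add_sub_cancel] at this
    -- Here `x` is injective on `M / N`, so the submodule `(N : x)` is no larger. Induction on the
    -- degree, which is bounded below, replaces the induction on `N`; it advances because `i > 0`.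
    · rw [← heq] at step
      obtain ⟨n₀, hn₀⟩ := exists_eq_bot_of_finite 𝒜 ℳ hℳ
      have key : ∀ k : ℕ, ∀ j < n₀ + k, Module.Finite K (ℳ j ⧸ gradedPiece ℳ N j) := by
        intro k
        induction k with
        | zero =>
          intro j hj
          have : Subsingleton (ℳ j) := by
            rw [hn₀ j (by simpa using hj)]
            infer_instance
          infer_instance
        | succ k ihk =>
          intro j hj
          have := step (j - i) (ihk _ (by push_cast at hj; omega))
          rwa [add_sub_cancel] at this
      exact key (n - n₀ + 1).toNat n (by omega)

theorem hilbertFun_add [IsNoetherianRing R]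
    (h𝒜 : (𝒜 0 : Set R) = Set.range (algebraMap K R))
    (hℳ : ∀ (i : ℕ) (j : ℤ) (r : R) (m : M), r ∈ 𝒜 i → m ∈ ℳ j → r • m ∈ ℳ ((i : ℤ) + j))
    {N : Submodule R M} (hN : IsHomogeneousSubmodule ℳ N) {i : ℕ} {x : R} (hx : x ∈ 𝒜 i) :
    (seqShift ^ i) (hilbertFun ℳ N) = hilbertFun ℳ (N.comap (LinearMap.lsmul R M x)) +
      (seqShift ^ i) (hilbertFun ℳ (N ⊔ x • (⊤ : Submodule R M))) := by
  ext j
  have := finite_gradedPiece h𝒜 hℳ N hN (i + j)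
  rw [Pi.add_apply, seqShift_pow_apply, seqShift_pow_apply, add_comm j]
  have h := finrank_quotient_eq_add (gradedMul 𝒜 ℳ hℳ hx j) (gradedPiece ℳ N (i + j))
  rw [hN.gradedPiece_sup_range hℳ hx j] at h
  rw [comap_gradedMul] at h
  simp only [hilbertFun]
  exact_mod_cast h

/-- `S` collects the factors that cost nothing and `D` the degrees whose factor `X ^ d - 1` lies in
`S`. Only elements of other degrees spend factors `X ^ q - 1`, and they do so only after the
elements with degree in `D` have come to kill the module. -/
theorem exists_annihilates_hilbertFun [IsNoetherianRing R]
    (h𝒜 : (𝒜 0 : Set R) = Set.range (algebraMap K R))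
    (hℳ : ∀ (i : ℕ) (j : ℤ) (r : R) (m : M), r ∈ 𝒜 i → m ∈ ℳ j → r • m ∈ ℳ ((i : ℤ) + j))
    (S : Submonoid ℂ[X]) (D : Set ℕ) (q : ℕ)
    (hD : ∀ d ∈ D, 0 < d ∧ (X ^ d - 1 : ℂ[X]) ∈ S)
    (hS : ∀ d : ℕ, 0 < d → ∃ g ∈ S, (X ^ d - 1 : ℂ[X]) ∣ g * (X ^ q - 1))
    (N : Submodule R M) (hN : IsHomogeneousSubmodule ℳ N) (e : ℕ)
    (he : Module.supportDim R (M ⧸ (N ⊔ Ideal.span {x : R | ∃ i ∈ D, x ∈ 𝒜 i} •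
      (⊤ : Submodule R M))) ≤ (e : WithBot ℕ∞)) :
    ∃ g ∈ S, Annihilates (g * (X ^ q - 1) ^ e) (hilbertFun ℳ N) := by
  have : IsNoetherian R M := isNoetherian_of_isNoetherianRing_of_finite R M
  set I : Ideal R := Ideal.span {x : R | ∃ i ∈ D, x ∈ 𝒜 i} with hI
  induction N using WellFoundedGT.induction generalizing e with
  | ind N ih =>
    by_cases hA : ∀ i : ℕ, 0 < i → ∀ x ∈ 𝒜 i, ∀ m : M, x • m ∈ N
    · exact ⟨1, S.one_mem, Annihilates.of_mem _
        (hilbertFun_mem_eventuallyZero_of_forall_smul_mem h𝒜 hN hA)⟩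
    push Not at hA
    -- If `x` acts neither as zero nor injectively on `M / N`, both `(N : x)` and `N + xM` are
    -- strictly larger than `N`. Otherwise every homogeneous element acts as zero or injectively.
    by_cases hB : ∃ i : ℕ, ∃ x ∈ 𝒜 i, ∃ m : M, x • m ∉ N ∧ ∃ m' ∉ N, x • m' ∈ N
    · obtain ⟨i, x, hx, m, hm, m', hm', hxm'⟩ := hB
      have hlt : N < N.comap (LinearMap.lsmul R M x) :=
        lt_of_le_of_ne (le_comap_lsmul N x) fun h => hm' (h ▸ hxm')
      have hlt' := lt_sup_smul_top hm
      obtain ⟨g, hg, hga⟩ := ih _ hlt (hN.comap_lsmul hℳ hx) e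
        ((supportDim_quotient_anti (sup_le_sup_right hlt.le _)).trans he)
      obtain ⟨g', hg', hga'⟩ := ih _ hlt' (hN.sup_smul_top hℳ hx) e
        ((supportDim_quotient_anti (sup_le_sup_right hlt'.le _)).trans he)
      refine ⟨g * g', S.mul_mem hg hg', ?_⟩
      rw [← Annihilates.seqShift_pow_iff (k := i), hilbertFun_add h𝒜 hℳ hN hx]
      refine (hga.of_dvd ⟨g', by ring⟩).add (Annihilates.seqShift_pow_iff.mpr
        (hga'.of_dvd ⟨g, by ring⟩))
    push Not at hB
    have hreg : ∀ i : ℕ, ∀ x ∈ 𝒜 i, ∀ m : M, x • m ∉ N → ∀ m' : M, x • m' ∈ N → m' ∈ N :=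
      fun i x hx m hm m' hm' => by_contra fun h => hB i x hx m hm m' h hm'
    have hdiff : ∀ i : ℕ, ∀ x ∈ 𝒜 i, ∀ m : M, x • m ∉ N →
        aeval seqShift (X ^ i - 1 : ℂ[X]) (hilbertFun ℳ N) =
          (seqShift ^ i) (hilbertFun ℳ (N ⊔ x • (⊤ : Submodule R M))) := by
      intro i x hx m hm
      have hcomap : N.comap (LinearMap.lsmul R M x) = N :=
        le_antisymm (fun m' hm' => hreg i x hx m hm m' hm') (le_comap_lsmul N x)
      have := hilbertFun_add h𝒜 hℳ hN hx
      rw [hcomap] at this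
      rw [map_sub, map_pow, aeval_X, map_one, LinearMap.sub_apply, Module.End.one_apply, this,
        add_sub_cancel_left]
    by_cases hC : ∃ i ∈ D, ∃ x ∈ 𝒜 i, ∃ m : M, x • m ∉ N
    · obtain ⟨i, hi, x, hx, m, hm⟩ := hC
      have hlt := lt_sup_smul_top hm
      obtain ⟨g, hg, hga⟩ := ih _ hlt (hN.sup_smul_top hℳ hx) e
        ((supportDim_quotient_anti (sup_le_sup_right hlt.le _)).trans he)
      refine ⟨g * (X ^ i - 1), S.mul_mem hg (hD i hi).2, ?_⟩
      rw [mul_right_comm, Annihilates.mul_iff, hdiff i x hx m hm,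
        Annihilates.seqShift_pow_iff]
      exact hga
    push Not at hC
    have hIN : I • (⊤ : Submodule R M) ≤ N := by
      rw [Submodule.smul_le]
      intro r hr m _
      have : I ≤ N.colon Set.univ := Ideal.span_le.mpr fun x ⟨i, hi, hx⟩ =>
        Submodule.mem_colon.mpr fun m _ => hC i hi x hx m
      exact Submodule.mem_colon.mp (this hr) m trivial
    rw [sup_eq_left.mpr hIN] at he
    obtain ⟨i, hi, x, hx, m, hm⟩ := hA
    have hdim := (supportDim_quotient_sup_smul_top_succ_le (hreg i x hx m hm)).trans he
    -- The zero module has dimension `⊥`, and `⊥ + 1 = ⊥`, so non-vanishing is needed to conclude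
    -- that `e` is positive.
    have hne : N ⊔ x • (⊤ : Submodule R M) ≠ ⊤ := by
      rw [← Submodule.ideal_span_singleton_smul]
      refine sup_span_smul_top_ne_top 𝒜 ℳ hℳ hN (fun h => hm (h ▸ trivial)) ?_
      rintro _ rfl
      exact ⟨i, hi, hx⟩
    have : Nontrivial (M ⧸ (N ⊔ x • (⊤ : Submodule R M))) :=
      Submodule.Quotient.nontrivial_iff.mpr hne
    obtain ⟨a, ha⟩ := WithBot.ne_bot_iff_exists.mp
      (Module.supportDim_ne_bot_of_nontrivial R (M ⧸ (N ⊔ x • (⊤ : Submodule R M))))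
    rw [← ha] at hdim
    have hdim' : a + 1 ≤ (e : ℕ∞) := by exact_mod_cast hdim
    obtain ⟨e', rfl⟩ : ∃ e', e = e' + 1 := by
      refine Nat.exists_eq_succ_of_ne_zero ?_
      rintro rfl
      simp at hdim'
    have hlt := lt_sup_smul_top hm
    obtain ⟨g, hg, hga⟩ := ih _ hlt (hN.sup_smul_top hℳ hx) e' (by
      refine (supportDim_quotient_anti le_sup_left).trans ?_
      rw [← ha]
      have h2 : a ≤ (e' : ℕ∞) := by
        push_cast at hdim'
        exact (ENat.add_le_add_iff_right ENat.one_ne_top).mp hdim'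
      exact_mod_cast h2)
    obtain ⟨g', hg', hdvd⟩ := hS i hi
    refine ⟨g * g', S.mul_mem hg hg', ?_⟩
    have h1 : Annihilates (g * (X ^ q - 1) ^ e' * (X ^ i - 1)) (hilbertFun ℳ N) := by
      rw [Annihilates.mul_iff, hdiff i x hx m hm, Annihilates.seqShift_pow_iff]
      exact hga
    refine h1.of_dvd ?_
    rw [show g * g' * (X ^ q - 1 : ℂ[X]) ^ (e' + 1) =
      g * (X ^ q - 1) ^ e' * (g' * (X ^ q - 1)) by ring]
    exact mul_dvd_mul_left _ hdvd

end Hilbert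

/-! ### Choices of free factors and the main theorem -/

/-- The divisors of powers of the polynomials `X ^ N - 1` with `N > 0`. -/
def cyclotomicSubmonoid : Submonoid ℂ[X] where
  carrier := {g | ∃ N L : ℕ, 0 < N ∧ g ∣ (X ^ N - 1) ^ L}
  one_mem' := ⟨1, 0, one_pos, one_dvd _⟩
  mul_mem' := by
    rintro g g' ⟨N, L, hN, hg⟩ ⟨N', L', hN', hg'⟩
    refine ⟨N * N', L + L', Nat.mul_pos hN hN', ?_⟩
    rw [pow_add]
    refine mul_dvd_mul (hg.trans (pow_dvd_pow_of_dvd ?_ _))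
      (hg'.trans (pow_dvd_pow_of_dvd ?_ _))
    · rw [pow_mul]
      exact sub_one_dvd_pow_sub_one _ _
    · rw [mul_comm, pow_mul]
      exact sub_one_dvd_pow_sub_one _ _

/-- The polynomials coprime to `p`. -/
def coprimeSubmonoid (p : ℂ[X]) : Submonoid ℂ[X] where
  carrier := {g | IsCoprime g p}
  one_mem' := isCoprime_one_left
  mul_mem' := IsCoprime.mul_left

theorem mainTheorem1 {K R M : Type*} [Field K]
    [CommRing R] [Algebra K R] [Algebra.FiniteType K R]
    (𝒜 : ℕ → Submodule K R) [GradedAlgebra 𝒜]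
    (h𝒜 : (𝒜 0 : Set R) = Set.range (algebraMap K R))
    [AddCommGroup M] [Module K M] [Module R M] [IsScalarTower K R M]
    [Module.Finite R M] [Nontrivial M]
    (ℳ : ℤ → Submodule K M) [DirectSum.Decomposition ℳ]
    (hℳ : ∀ (i : ℕ) (j : ℤ) (r : R) (m : M), r ∈ 𝒜 i → m ∈ ℳ j → r • m ∈ ℳ ((i : ℤ) + j)) :
    (∃! Q : QuasiPolynomial, Q.IsHilbert ℳ) ∧
    ∀ Q : QuasiPolynomial, Q.IsHilbert ℳ →
      (∀ i : ℕ, Module.supportDim R M ≤ (i : WithBot ℕ∞) → Q.coeff i = 0) ∧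
      ∃ e : ℕ,
        Module.supportDim R
          (M ⧸ (coprimeDegreeIdeal 𝒜 Q.period • (⊤ : Submodule R M))) = (e : WithBot ℕ∞) ∧
        Q.grade < (e : ℤ) := by
  have : IsNoetherianRing R := Algebra.FiniteType.isNoetherianRing K R
  have hbot : IsHomogeneousSubmodule ℳ (⊥ : Submodule R M) := by
    intro m hm n
    rw [(Submodule.mem_bot R).mp hm, map_zero]
    exact Submodule.zero_mem _
  have hfun : ∀ n, hilbertFun ℳ (⊥ : Submodule R M) n = Module.finrank K (ℳ n) := fun n => by
    have : gradedPiece ℳ (⊥ : Submodule R M) n = ⊥ := by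
      rw [eq_bot_iff]
      exact fun m hm => Subtype.ext hm
    rw [hilbertFun, this, (Submodule.quotEquivOfEqBot _ rfl).finrank_eq]
  have hann : ∀ (Q : QuasiPolynomial), Q.IsHilbert ℳ → ∀ p : ℂ[X],
      Annihilates p (hilbertFun ℳ (⊥ : Submodule R M)) → Annihilates p Q.eval :=
    fun Q hQ p hp => hp.congr (by
      filter_upwards [hQ] with n hn
      rw [Pi.sub_apply, hfun, hn, sub_self])
  obtain ⟨d, hd⟩ := exists_supportDim_eq (R := R) (M := M) K
  have hle : ∀ J : Submodule R M, Module.supportDim R (M ⧸ J) ≤ Module.supportDim R M :=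
    fun J => Module.supportDim_le_of_surjective J.mkQ J.mkQ_surjective
  refine ⟨?_, fun Q hQ => ⟨fun i hi => ?_, ?_⟩⟩
  -- For existence any annihilator dividing a power of some `X ^ N - 1` will do, so every positive
  -- degree is free and `q = 1`.
  · obtain ⟨g, ⟨N, L, hN, hg⟩, hga⟩ := exists_annihilates_hilbertFun h𝒜 hℳ cyclotomicSubmonoid
      {i | 0 < i} 1 (fun i hi => ⟨hi, i, 1, hi, by rw [pow_one]⟩)
      (fun i hi => ⟨X ^ i - 1, ⟨i, 1, hi, by rw [pow_one]⟩, Dvd.intro _ rfl⟩)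
      ⊥ hbot d ((hle _).trans hd.le)
    have hN' : Annihilates ((X ^ N - 1) ^ (L + d)) (hilbertFun ℳ (⊥ : Submodule R M)) := by
      rw [pow_one] at hga
      refine hga.of_dvd ?_
      rw [pow_add]
      exact mul_dvd_mul hg (pow_dvd_pow_of_dvd (sub_one_dvd_pow_sub_one (X : ℂ[X]) N) d)
    obtain ⟨Q, -, -, hQ⟩ := QuasiPolynomial.exists_of_annihilates hN hN'
    have hQ' : Q.IsHilbert ℳ := by
      filter_upwards [hQ] with n hn
      rw [hn, hfun]
    refine ⟨Q, hQ', fun Q' h => QuasiPolynomial.eq_of_eventuallyEq ?_⟩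
    filter_upwards [hQ', h] with n h1 h2
    rw [h1, h2]
  -- With no free degrees the ideal is zero, and the bound required is the one on the dimension of
  -- `M` itself.
  · obtain ⟨g, hg, hga⟩ := exists_annihilates_hilbertFun h𝒜 hℳ
      (coprimeSubmonoid (X ^ Q.period - 1)) ∅ Q.period (fun _ h => h.elim)
      (fun i hi => exists_isCoprime_dvd_X_pow_sub_one_mul hi _) ⊥ hbot i ((hle _).trans hi)
    exact QuasiPolynomial.coeff_eq_zero_of_annihilates hg (hann Q hQ _ hga) le_rfl
  · have hne : coprimeDegreeIdeal 𝒜 Q.period • (⊤ : Submodule R M) ≠ ⊤ := by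
      have := sup_span_smul_top_ne_top 𝒜 ℳ hℳ hbot bot_ne_top
        (s := {x : R | ∃ i : ℕ, 0 < i ∧ Nat.Coprime i Q.period ∧ x ∈ 𝒜 i})
        (fun x ⟨i, hi, _, hx⟩ => ⟨i, hi, hx⟩)
      rwa [bot_sup_eq] at this
    have : Nontrivial (M ⧸ (coprimeDegreeIdeal 𝒜 Q.period • (⊤ : Submodule R M))) :=
      Submodule.Quotient.nontrivial_iff.mpr hne
    obtain ⟨e, he⟩ := exists_supportDim_eq (R := R)
      (M := M ⧸ (coprimeDegreeIdeal 𝒜 Q.period • (⊤ : Submodule R M))) K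
    refine ⟨e, he, ?_⟩
    have hideal : Ideal.span {x : R | ∃ i ∈ {i : ℕ | 0 < i ∧ Nat.Coprime i Q.period}, x ∈ 𝒜 i} =
        coprimeDegreeIdeal 𝒜 Q.period := by
      simp only [coprimeDegreeIdeal, Set.mem_ofPred_eq, and_assoc]
    have hgeom : (∑ j ∈ Finset.range Q.period, X ^ j : ℂ[X]) ∣ X ^ Q.period - 1 :=
      ⟨X - 1, (geom_sum_mul X _).symm⟩
    obtain ⟨g, hg, hga⟩ := exists_annihilates_hilbertFun h𝒜 hℳ
      (coprimeSubmonoid (∑ j ∈ Finset.range Q.period, X ^ j))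
      {i | 0 < i ∧ Nat.Coprime i Q.period} Q.period
      (fun i hi => ⟨hi.1, X_pow_sub_one_isCoprime_geom_sum hi.2 Q.period_pos⟩)
      (fun i hi => by
        obtain ⟨g, hg, hdvd⟩ := exists_isCoprime_dvd_X_pow_sub_one_mul hi Q.period
        exact ⟨g, hg.of_isCoprime_of_dvd_right hgeom, hdvd⟩)
      ⊥ hbot e (by rw [hideal, bot_sup_eq]; exact he.le)
    -- The quotient is non-zero, so `e` is a natural number and `e - 1 ≥ -1` is an admissible grade.
    have hgrade : Q.grade ≤ (e : ℤ) - 1 := Q.isLeast_grade.2 ⟨by omega, fun i hi =>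
      QuasiPolynomial.exists_coeff_eq_of_annihilates hg (hann Q hQ _ hga) (by omega)⟩
    omega
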